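/- **Setting.** A list of $\ell$ distinct items is shared by $p$ processes; process $i$ has a finite request sequence $\sigma_i$ of items of the list. A *merge* of $\sigma_1,\dots,\sigma_p$ is an interleaving of their requests that respects the order of each $\sigma_i$. Locations in the list are numbered $1,\dots,\ell$ from the front. **DMTF at the item access level.** A *schedule* is a finite sequence of processes; in each of its steps the named process makes one item access (a process that has completed all its requests does nothing). Each process serves its requests in order, one search at a time, beginning with its first item access; a search for $a$ inspects the locations $1,2,3,\dots$ of the current list in turn. When a search reaches $a$, in location $k$ say, the item $a$ is moved to the front and the request is completed. Every other process that has at that moment begun and not completed a search for $a$ (and for which $a$ has not already been moved to the front by another process during this search) is assumed to find $a$ in the same location: it completes its request when it has made $k$ item accesses in this search, and it moves nothing. Say that $M_1$ is served under the schedule if all requests of all processes are completed and $M_1$ is the sequence of requests in order of completion, i.e. in the order in which processes move the requested item to the front or discover that it has been moved. For such a schedule, $\mathrm{DMTF}(M_1)$ denotes the total number of item accesses in the execution. **OPT.** For a request sequence $M_2$, $\mathrm{OPT}(M_2)$ is the minimum cost of serving $M_2$ sequentially offline, from the same initial list as DMTF: accessing the item in location $k$ costs $k$, after which it may be moved free of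 charge to any location closer to the front; exchanging two adjacent items at any time costs $1$. **Theorem.** For all $p$ and $\ell$ there is a constant $K$, depending only on $p$ and $\ell$, such that for every initial list of $\ell$ items, all request sequences $\sigma_1,\dots,\sigma_p$, any two merges $M_1$, $M_2$ of them, and every schedule under which DMTF serves $M_1$, $$\mathrm{DMTF}(M_1) \le (4p^2-2p)\,\mathrm{OPT}(M_2) + K .$$ -/

import Mathlib

namespace ListAccess

variable {α : Type*} {p : ℕ}

/-- `M` is a merge of the request sequences `σ 0, …, σ (p - 1)`: every entry of `M` is a request
tagged with the process that issues it, and the requests of process `i`, in the order in which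
they occur in `M`, form the sequence `σ i`. -/
def IsMerge (σ : Fin p → List α) (M : List (Fin p × α)) : Prop :=
  ∀ i, (M.filter fun r => decide (r.1 = i)).map Prod.snd = σ i

/-! ### Sequential offline list accessing -/

/-- `OfflineCost L I c`: starting from the list `L`, the request sequence `I` can be served
sequentially with total cost `c`. Accessing the item in location `k` costs `k` (locations are
counted from `1`), after which the item may be moved, free of charge, to any location closer to
the front. At any time two adjacent items may be exchanged at cost `1`. -/
inductive OfflineCost : List α → List α → ℕ → Prop
  | done (L : List α) : OfflineCost L [] 0
  | exchange (u v : List α) (x y : α) (I : List α) (c : ℕ) :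
      OfflineCost (u ++ y :: x :: v) I c → OfflineCost (u ++ x :: y :: v) I (c + 1)
  | access (u v w : List α) (a : α) (I : List α) (c : ℕ) :
      OfflineCost (u ++ a :: (v ++ w)) I c →
        OfflineCost (u ++ v ++ a :: w) (a :: I) ((u ++ v).length + 1 + c)

/-- Some offline service exists as soon as all requested items are in the list. -/
theorem exists_offlineCost (L I : List α) (h : ∀ a ∈ I, a ∈ L) : ∃ c, OfflineCost L I c := by
  induction I with
  | nil => exact ⟨0, .done L⟩
  | cons a I ih =>
    obtain ⟨c, hc⟩ := ih fun b hb => h b (List.mem_cons_of_mem _ hb)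
    obtain ⟨u, w, rfl⟩ := List.append_of_mem (h a List.mem_cons_self)
    have := OfflineCost.access u [] w a I c (by simpa using hc)
    exact ⟨_, by simpa using this⟩

/-- The cost of an optimal sequential offline algorithm on the request sequence `I`, starting
from the list `L`. -/
noncomputable def opt (L I : List α) : ℕ := sInf {c | OfflineCost L I c}

/-! ### Distributed Move-to-Front with interleaving at the item access level -/

/-- The local state of a process. -/
structure Searcher (α : Type*) where
  /-- the requests not yet completed; the head is the current one -/
  pending : List α
  /-- the number of item accesses made so far in the search for the current request
  (`0` if this search has not begun) -/
  inspected : ℕ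
  /-- `some k` if, since the beginning of the current search, another process has found the
  requested item in location `k` and has moved it to the front -/
  foundAt : Option ℕ

/-- A configuration of the system. -/
structure Config (p : ℕ) (α : Type*) where
  /-- the shared list -/
  list : List α
  /-- the processes -/
  procs : Fin p → Searcher α
  /-- the completed requests, in the order in which they were completed -/
  served : List (Fin p × α)
  /-- the total number of item accesses -/
  cost : ℕ

/-- The initial configuration. -/
def Config.init (L : List α) (σ : Fin p → List α) : Config p α where
  list := L
  procs i := ⟨σ i, 0, none⟩
  served := []
  cost := 0

variable [DecidableEq α]

/-- A process that is in the middle of a search for `a` when another process finds `a` in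
location `k` and moves it to the front will find `a` in that same location `k`. -/
def Searcher.notify (a : α) (k : ℕ) (P : Searcher α) : Searcher α :=
  if P.pending.head? = some a ∧ 0 < P.inspected ∧ P.foundAt = none then
    { P with foundAt := some k }
  else P

/-- One step of process `i`, which is one item access (or nothing, if the process has completed
all its requests). A search inspects the locations `1, 2, 3, …` of the shared list in turn.

* If the requested item has not been moved by another process during this search, the next
  location of the current list is inspected. If it holds the item, the item is moved to the
  front, the other processes that are searching for this item are notified of the location in
  which it was found, and the request is completed.
* If another process has in the meantime found the item in location `k` and moved it to the
  front, the search goes on to location `k`, where it is completed; nothing is moved. -/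
def step (C : Config p α) (i : Fin p) : Config p α :=
  match (C.procs i).pending with
  | [] => C
  | a :: rest =>
    let n := (C.procs i).inspected
    let goOn : Config p α :=
      { C with
        procs := Function.update C.procs i { C.procs i with inspected := n + 1 }
        cost := C.cost + 1 }
    match (C.procs i).foundAt with
    | none =>
      if C.list[n]? = some a then
        { list := a :: C.list.erase a
          procs := Function.update (fun j => (C.procs j).notify a (n + 1)) i ⟨rest, 0, none⟩
          served := C.served ++ [(i, a)]
          cost := C.cost + 1 }
      else goOn
    | some k =>
      if n + 1 = k then
        { C with
          procs := Function.update C.procs i ⟨rest, 0, none⟩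
          served := C.served ++ [(i, a)]
          cost := C.cost + 1 }
      else goOn

/-- The final configuration of the execution on the request sequences `σ`, starting from the
list `L`, in which the processes take steps in the order given by the schedule `s`. -/
def dmtf (L : List α) (σ : Fin p → List α) (s : List (Fin p)) : Config p α :=
  s.foldl step (Config.init L σ)

/-- Under the schedule `s`, all requests are completed, in the order given by `M`: this is the
order in which the processes move the requested item to the front or discover that another
process has moved it. -/
def DMTFServes (L : List α) (σ : Fin p → List α) (s : List (Fin p)) (M : List (Fin p × α)) :
    Prop :=
  (∀ i, ((dmtf L σ s).procs i).pending = []) ∧ (dmtf L σ s).served = M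

/-- The cost of distributed Move-to-Front under the schedule `s`: its total number of item
accesses. -/
def dmtfCost (L : List α) (σ : Fin p → List α) (s : List (Fin p)) : ℕ :=
  (dmtf L σ s).cost

end ListAccess

/-!
Let every process `k` serve its requests alone by sequential Move-to-Front, in a list of its own.
The sequence of its requests is a subsequence of `M₂`, so that the usual count of inversions bounds
the cost of this by `2 * OPT(M₂)`. It remains to bound the distributed cost by `2 * p - 1` times
the total cost in the own lists, up to a constant.

When `k` finds `x` in the shared list, sort the items in front of `x` by the process `j` that was
the last to move them. Those with `j = k` are in front of `x` in the own list of `k` as well. If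
`j ≠ k` then all items that `k` has requested since `j` moved `y` are in front of `x` in the own
list of `k`, and `x` is a new one. So the number of these items, capped at the location of `y` in
the own list of `j`, serves as a credit for `y`. Passing `y` makes the credit grow, unless it has
reached the cap; but then the location of `y` in the own list of `j` is smaller than that of `x` in
the own list of `k`, which is true of few `y` only. The credit is lost only when `j` requests `y`
again, at a cost in its own list that is at least the credit.
-/

namespace ListAccess

section Lists

variable {α : Type*} [DecidableEq α] {L : List α} {a x y z : α}

/-- The set of items in front of `x` in `L`, that is, of the items that a search for `x` inspects
in vain; all items of `L` if `x` is not among them. -/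
def ahead (L : List α) (x : α) : Finset α := (L.takeWhile (· != x)).toFinset

/-- The list `L` after `a` has been moved to the front. -/
def moveToFront (a : α) (L : List α) : List α := a :: L.erase a

/-- The cost of sequential Move-to-Front on the request sequence `I`, starting from `L`. -/
def mtfCost : List α → List α → ℕ
  | _, [] => 0
  | L, a :: I => L.idxOf a + 1 + mtfCost (moveToFront a L) I

theorem ahead_cons (b : α) (L : List α) (x : α) :
    ahead (b :: L) x = if b = x then ∅ else insert b (ahead L x) := by
  by_cases h : b = x <;> simp [ahead, h]

theorem ahead_append (u w : List α) (x : α) :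
    ahead (u ++ w) x = if x ∈ u then ahead u x else u.toFinset ∪ ahead w x := by
  induction u with
  | nil => simp
  | cons b u ih => by_cases hb : b = x <;> by_cases hu : x ∈ u <;> simp_all [ahead_cons, eq_comm]

theorem ahead_subset_toFinset (L : List α) (x : α) : ahead L x ⊆ L.toFinset := fun _ hy =>
  List.mem_toFinset.2 ((List.takeWhile_sublist _).subset (List.mem_toFinset.1 hy))

theorem notMem_ahead_self (L : List α) (x : α) : x ∉ ahead L x := fun h => by
  simpa using List.mem_takeWhile_imp (List.mem_toFinset.1 h)

theorem mem_ahead_of_notMem_ahead (hy : y ∈ L) (hxy : x ≠ y) (h : x ∉ ahead L y) :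
    y ∈ ahead L x := by
  induction L with
  | nil => simp at hy
  | cons b L ih => grind [ahead_cons]

theorem card_ahead (hL : L.Nodup) (x : α) : (ahead L x).card = L.idxOf x := by
  induction L with
  | nil => rfl
  | cons b L ih =>
    obtain ⟨hb, hL⟩ := List.nodup_cons.1 hL
    rcases eq_or_ne b x with rfl | hbx
    · simp [ahead_cons]
    · have : b ∉ ahead L x := fun h => hb (List.mem_toFinset.1 (ahead_subset_toFinset L x h))
      rw [ahead_cons, if_neg hbx, Finset.card_insert_of_notMem this, ih hL,
        List.idxOf_cons_ne L hbx]

theorem card_ahead_append_cons_le (u w : List α) (a : α) :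
    (ahead (u ++ a :: w) a).card ≤ u.length := by
  refine (Finset.card_le_card ?_).trans (List.toFinset_card_le u)
  rw [ahead_append, ahead_cons, if_pos rfl]
  split_ifs
  · exact ahead_subset_toFinset u a
  · simp

theorem ahead_moveToFront_self (a : α) (L : List α) : ahead (moveToFront a L) a = ∅ := by
  simp [moveToFront, ahead_cons]

theorem ahead_moveToFront_of_ne (hz : z ≠ a) (L : List α) :
    ahead (moveToFront a L) z = insert a (ahead L z) := by
  rw [moveToFront, ahead_cons, if_neg hz.symm]
  induction L with
  | nil => rfl
  | cons b L ih =>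
    rcases eq_or_ne b a with rfl | hba
    · simp [ahead_cons, hz.symm]
    · rw [List.erase_cons_tail (by simpa using hba), ahead_cons, ahead_cons]
      split_ifs
      · rfl
      · rw [Finset.insert_comm, ih, Finset.insert_comm]

theorem nodup_moveToFront (hL : L.Nodup) (a : α) : (moveToFront a L).Nodup :=
  List.nodup_cons.2 ⟨hL.not_mem_erase, hL.erase a⟩

theorem moveToFront_perm (ha : a ∈ L) : (moveToFront a L).Perm L :=
  (List.perm_cons_erase ha).symm

theorem ahead_subset_ahead_of_moveForward (u v w : List α) (hz : z ≠ a) :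
    ahead (u ++ v ++ a :: w) z ⊆ ahead (u ++ a :: (v ++ w)) z := by
  intro b
  simp only [ahead_append, ahead_cons, List.mem_append, List.toFinset_append]
  grind

end Lists

section Offline

variable {α : Type*} [DecidableEq α] {L A B : List α} {a : α} {T : Finset α}

/-- The number of pairs `(x, y)` with `y ∈ T` such that `x` is in front of `y` in `L` but not in
`L'`: the potential in the comparison of Move-to-Front, which maintains `L`, with an offline
algorithm, which maintains `L'`. -/
def disorder (T : Finset α) (L L' : List α) : ℕ := ∑ y ∈ T, (ahead L y \ ahead L' y).card

theorem disorder_self (T : Finset α) (L : List α) : disorder T L L = 0 := by simp [disorder]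

theorem disorder_exchange_le (T : Finset α) (L u v : List α) (x y : α) :
    disorder T L (u ++ y :: x :: v) ≤ disorder T L (u ++ x :: y :: v) + 1 := by
  have hpoint : ∀ z, (ahead L z \ ahead (u ++ y :: x :: v) z).card ≤
      (ahead L z \ ahead (u ++ x :: y :: v) z).card + if z = y then 1 else 0 := fun z => by
    split_ifs with hz
    · subst hz
      refine le_trans (Finset.card_le_card ?_)
        (Finset.card_insert_le x (ahead L z \ ahead (u ++ x :: z :: v) z))
      intro b
      simp only [ahead_append, ahead_cons]
      grind
    · have hsub : ahead (u ++ x :: y :: v) z ⊆ ahead (u ++ y :: x :: v) z := by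
        simpa using ahead_subset_ahead_of_moveForward u [x] v hz
      exact Finset.card_le_card (Finset.sdiff_subset_sdiff le_rfl hsub)
  refine (Finset.sum_le_sum fun z _ => hpoint z).trans ?_
  rw [Finset.sum_add_distrib, Finset.sum_ite_eq', disorder]
  split_ifs <;> omega

theorem disorder_le_add_card_ahead (hAB : ∀ z ≠ a, ahead A z ⊆ ahead B z) :
    disorder T L B ≤ disorder T L A + (ahead A a).card := by
  have hpoint : ∀ z, (ahead L z \ ahead B z).card ≤
      (ahead L z \ ahead A z).card + if z = a then (ahead A a).card else 0 := fun z => by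
    split_ifs with hz
    · subst hz
      exact (Finset.card_le_card (t := ahead L z) Finset.sdiff_subset).trans
        Finset.card_le_card_sdiff_add_card
    · exact Finset.card_le_card (Finset.sdiff_subset_sdiff le_rfl (hAB z hz))
  refine (Finset.sum_le_sum fun z _ => hpoint z).trans ?_
  rw [Finset.sum_add_distrib, Finset.sum_ite_eq', disorder]
  split_ifs <;> omega

theorem card_ahead_add_disorder_moveToFront_le (haA : a ∈ A) (haT : a ∈ T)
    (hAB : ∀ z ≠ a, ahead A z ⊆ ahead B z) :
    (ahead L a).card + disorder T (moveToFront a L) B ≤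
      disorder T L A + 2 * (ahead A a).card := by
  have hpoint : ∀ z, (if z = a then (ahead L a \ ahead A a).card else 0) +
      (ahead (moveToFront a L) z \ ahead B z).card ≤
      (ahead L z \ ahead A z).card + if z ∈ ahead A a then 1 else 0 := fun z => by
    rcases eq_or_ne z a with rfl | hz
    · simp [ahead_moveToFront_self]
    rw [if_neg hz, zero_add, ahead_moveToFront_of_ne hz]
    refine (Finset.card_le_card (Finset.sdiff_subset_sdiff le_rfl (hAB z hz))).trans ?_
    split_ifs with hzA
    · exact le_trans (Finset.card_le_card fun b => by grind)
        (Finset.card_insert_le a (ahead L z \ ahead A z))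
    · rw [Finset.insert_sdiff_of_mem _ (mem_ahead_of_notMem_ahead haA hz hzA), add_zero]
  have hsum := Finset.sum_le_sum fun z (_ : z ∈ T) => hpoint z
  rw [Finset.sum_add_distrib, Finset.sum_add_distrib, Finset.sum_ite_eq', if_pos haT,
    Finset.sum_ite_mem, Finset.sum_const, smul_eq_mul, mul_one] at hsum
  have hinter := Finset.card_le_card (Finset.inter_subset_right (s₁ := T) (s₂ := ahead A a))
  have hsdiff := Finset.card_le_card_sdiff_add_card (s := ahead L a) (t := ahead A a)
  unfold disorder
  omega

theorem OfflineCost.mtfCost_le {L' I : List α} {c : ℕ} (hc : OfflineCost L' I c) {J : List α}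
    (hL : L.Nodup) (hJ : J.Sublist I) (hT : ∀ a ∈ J, a ∈ T) :
    mtfCost L J ≤ 2 * c + disorder T L L' := by
  induction hc generalizing L J with
  | done L' => simp [List.sublist_nil.1 hJ, mtfCost]
  | exchange u v x y I c _ ih =>
    have hrest := ih hL hJ hT
    have hdis := disorder_exchange_le T L u v x y
    omega
  | access u v w a I c _ ih =>
    have hAB : ∀ z ≠ a, ahead (u ++ v ++ a :: w) z ⊆ ahead (u ++ a :: (v ++ w)) z := fun z hz =>
      ahead_subset_ahead_of_moveForward u v w hz
    have hcost := card_ahead_append_cons_le (u ++ v) w a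
    cases hJ with
    | cons _ hJ =>
      have hrest := ih hL hJ hT
      have hdis := disorder_le_add_card_ahead (T := T) (L := L) hAB
      omega
    | @cons_cons J _ _ hJ =>
      have hrest := ih (nodup_moveToFront hL a) hJ fun b hb => hT b (List.mem_cons_of_mem a hb)
      have hdis := card_ahead_add_disorder_moveToFront_le (L := L) (by simp)
        (hT a List.mem_cons_self) hAB
      rw [card_ahead hL] at hdis
      rw [mtfCost]
      omega

theorem mtfCost_le_two_mul_opt {I J : List α} (hL : L.Nodup) (hI : ∀ a ∈ I, a ∈ L)
    (hJ : J.Sublist I) : mtfCost L J ≤ 2 * opt L I := by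
  have hopt : OfflineCost L I (opt L I) := Nat.sInf_mem (exists_offlineCost L I hI)
  simpa [disorder_self] using hopt.mtfCost_le (T := J.toFinset) hL hJ (by simp)

end Offline

section Distributed

variable {ι α : Type*}

/-- What the analysis records of an execution of distributed Move-to-Front. An event of the
execution is that some process finds its item and moves it to the front of the shared list,
which answers the requests of all processes that are searching for this item. -/
structure History (ι α : Type*) where
  /-- the list shared by the processes -/
  shared : List α
  /-- the list that the process would maintain if it served its requests alone -/
  own : ι → List α
  /-- the process that was the last to move the item to the front of the shared list -/
  mover : α → ι
  /-- `recent k j y` is the set of items requested by `k` since the last request of `j` for `y`,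
  including the requests answered by the same event as that request -/
  recent : ι → ι → α → Finset α

namespace History

/-- The relations between the components of a history that hold in all executions. -/
structure Valid [DecidableEq α] (D : History ι α) : Prop where
  nodup : D.shared.Nodup
  perm : ∀ k, (D.own k).Perm D.shared
  mem_recent_self : ∀ k y, y ∈ D.recent k k y
  recent_subset : ∀ k y z, y ∈ ahead D.shared z → D.recent k (D.mover y) y ⊆ ahead (D.own k) z

/-- The history before the first event. By convention, `i₀` is the last process to have moved
any item, and each item counts as recently requested by all processes. -/
def init (L : List α) (i₀ : ι) : History ι α where
  shared := L
  own _ := L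
  mover _ := i₀
  recent _ _ y := {y}

variable [DecidableEq α] {D : History ι α} {x y z : α}

/-- The share of the item `y` in `D.credit k j`. It is capped at the cost of a request for `y` in
the own list of `j`, because such a request of `j` annihilates it. -/
def itemCredit (D : History ι α) (k j : ι) (y : α) : ℕ :=
  min (D.recent k j y).card ((D.own j).idxOf y + 1)

/-- The potential that pays for the inspections which `k` makes in the shared list, but would not
make in its own list, of items moved to the front by `j`. -/
def credit (D : History ι α) (k j : ι) : ℕ := ∑ y ∈ D.shared.toFinset, D.itemCredit k j y

theorem Valid.init {L : List α} (hL : L.Nodup) (i₀ : ι) : (init L i₀).Valid where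
  nodup := hL
  perm _ := List.Perm.refl L
  mem_recent_self _ _ := Finset.mem_singleton_self _
  recent_subset _ _ _ := Finset.singleton_subset_iff.2

theorem Valid.nodup_own (hD : D.Valid) (k : ι) : (D.own k).Nodup :=
  (hD.perm k).nodup_iff.2 hD.nodup

variable [DecidableEq ι] {S : Finset ι} {i j k : ι}

/-- The history after the process `i` has moved `x` to the front of the shared list, thereby
answering the requests for `x` of the processes in `S`. -/
def request (D : History ι α) (x : α) (S : Finset ι) (i : ι) : History ι α where
  shared := moveToFront x D.shared
  own k := if k ∈ S then moveToFront x (D.own k) else D.own k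
  mover := Function.update D.mover x i
  recent k j y := (if y = x ∧ j ∈ S then ∅ else D.recent k j y) ∪ if k ∈ S then {x} else ∅

theorem ahead_own_request (D : History ι α) (S : Finset ι) (i k : ι) (hz : z ≠ x) :
    ahead ((D.request x S i).own k) z = ahead (D.own k) z ∪ if k ∈ S then {x} else ∅ := by
  by_cases hk : k ∈ S
  · simp [request, hk, ahead_moveToFront_of_ne hz]
  · simp [request, hk]

theorem Valid.request (hD : D.Valid) (hx : x ∈ D.shared) (hi : i ∈ S) :
    (D.request x S i).Valid where
  nodup := nodup_moveToFront hD.nodup x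
  perm k := by
    have hshared : D.shared.Perm (D.request x S i).shared := (moveToFront_perm hx).symm
    by_cases hk : k ∈ S
    · have hown : ((D.request x S i).own k).Perm (D.own k) := by
        simpa [History.request, hk] using moveToFront_perm ((hD.perm k).mem_iff.2 hx)
      exact hown.trans ((hD.perm k).trans hshared)
    · simpa [History.request, hk] using (hD.perm k).trans hshared
  mem_recent_self k y := by
    have := hD.mem_recent_self k y
    simp only [History.request]
    grind
  recent_subset k y z hy := by
    rcases eq_or_ne z x with rfl | hz
    · simp [History.request, ahead_moveToFront_self] at hy
    rw [ahead_own_request D S i k hz]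
    refine Finset.union_subset_union_left ?_
    rcases eq_or_ne y x with rfl | hyx
    · simp [History.request, hi]
    · have hy' : y ∈ ahead D.shared z := by
        simpa [History.request, ahead_moveToFront_of_ne hz, hyx] using hy
      simpa [History.request, hyx] using hD.recent_subset k y z hy'

theorem Valid.idxOf_own_le_request (hD : D.Valid) (i : ι) (h : ¬(y = x ∧ k ∈ S)) :
    (D.own k).idxOf y ≤ ((D.request x S i).own k).idxOf y := by
  by_cases hk : k ∈ S
  · have hy : y ≠ x := fun hy => h ⟨hy, hk⟩
    simp only [History.request, if_pos hk]
    rw [← card_ahead (hD.nodup_own k), ← card_ahead (nodup_moveToFront (hD.nodup_own k) x),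
      ahead_moveToFront_of_ne hy]
    exact Finset.card_le_card (Finset.subset_insert _ _)
  · simp [History.request, hk]

/-- The items in front of `x` in the shared list that were last moved by process `j`. -/
def movedAhead (D : History ι α) (j : ι) (x : α) : Finset α :=
  (ahead D.shared x).filter fun y => D.mover y = j

theorem Valid.card_recent_le (hD : D.Valid) (k : ι) (hy : y ∈ D.movedAhead j x) :
    (D.recent k j y).card ≤ (D.own k).idxOf x := by
  obtain ⟨hyx, rfl⟩ := Finset.mem_filter.1 hy
  rw [← card_ahead (hD.nodup_own k)]
  exact Finset.card_le_card (hD.recent_subset k y x hyx)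

theorem Valid.card_movedAhead_self_le (hD : D.Valid) (k : ι) (x : α) :
    (D.movedAhead k x).card ≤ (D.own k).idxOf x := by
  rw [← card_ahead (hD.nodup_own k)]
  refine Finset.card_le_card fun y hy => ?_
  obtain ⟨hyx, rfl⟩ := Finset.mem_filter.1 hy
  exact hD.recent_subset _ y x hyx (hD.mem_recent_self _ y)

theorem Valid.sum_card_movedAhead [Fintype ι] (hD : D.Valid) (x : α) :
    ∑ j, (D.movedAhead j x).card = D.shared.idxOf x := by
  rw [← card_ahead hD.nodup]
  exact (Finset.card_eq_sum_card_fiberwise fun y _ => Finset.mem_univ (D.mover y)).symm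

theorem Valid.card_saturated_le (hD : D.Valid) (k j : ι) (x : α) :
    ((D.movedAhead j x).filter fun y => (D.own j).idxOf y < (D.recent k j y).card).card ≤
      (D.own k).idxOf x := by
  rw [← Finset.card_range ((D.own k).idxOf x)]
  refine Finset.card_le_card_of_injOn (D.own j).idxOf (fun y hy => ?_) fun y hy z _ hyz => ?_
  · obtain ⟨hy, hsat⟩ := Finset.mem_filter.1 hy
    exact Finset.mem_coe.2 (Finset.mem_range.2 (hsat.trans_le (hD.card_recent_le k hy)))
  · have hy : y ∈ D.own j := (hD.perm j).mem_iff.2 <| List.mem_toFinset.1 <|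
      ahead_subset_toFinset _ _ (Finset.mem_filter.1 (Finset.mem_filter.1 hy).1).1
    exact (List.idxOf_inj hy).1 hyz

theorem Valid.itemCredit_le (hD : D.Valid) (x : α) (S : Finset ι) (i k j : ι) (y : α) :
    D.itemCredit k j y ≤ (D.request x S i).itemCredit k j y +
      if y = x ∧ j ∈ S then (D.own j).idxOf y + 1 else 0 := by
  split_ifs with h
  · exact (min_le_right _ _).trans (Nat.le_add_left _ _)
  · refine min_le_min (Finset.card_le_card ?_)
      (Nat.add_le_add_right (hD.idxOf_own_le_request i h) 1)
    simp [History.request, h]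

theorem Valid.itemCredit_lt (hD : D.Valid) (i : ι) (hk : k ∈ S)
    (hy : y ∈ D.movedAhead j x) (hcap : (D.recent k j y).card ≤ (D.own j).idxOf y) :
    D.itemCredit k j y < (D.request x S i).itemCredit k j y := by
  obtain ⟨hyx, hj⟩ := Finset.mem_filter.1 hy
  have hne : y ≠ x := by
    rintro rfl
    exact notMem_ahead_self _ _ hyx
  have hxrecent : x ∉ D.recent k j y := fun hmem =>
    notMem_ahead_self (D.own k) x (hD.recent_subset k y x hyx (hj ▸ hmem))
  have hrecent : ((D.request x S i).recent k j y).card = (D.recent k j y).card + 1 := by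
    simp [History.request, hne, hk, hxrecent]
  have hidx := hD.idxOf_own_le_request (S := S) (k := j) i fun h => hne h.1
  unfold itemCredit
  omega

theorem Valid.credit_add_card_le (hD : D.Valid) (hx : x ∈ D.shared) (i : ι) {U : Finset α}
    (hU : U ⊆ D.shared.toFinset)
    (hlt : ∀ y ∈ U, D.itemCredit k j y < (D.request x S i).itemCredit k j y) :
    D.credit k j + U.card ≤
      (D.request x S i).credit k j + if j ∈ S then (D.own j).idxOf x + 1 else 0 := by
  have hpoint : ∀ y, D.itemCredit k j y + (if y ∈ U then 1 else 0) ≤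
      (D.request x S i).itemCredit k j y +
        if y = x then (if j ∈ S then (D.own j).idxOf x + 1 else 0) else 0 := fun y => by
    split_ifs with hyU hyx hj
    · exact Nat.le_add_right_of_le (hlt y hyU)
    · exact Nat.le_add_right_of_le (hlt y hyU)
    · exact hlt y hyU
    all_goals simpa [*] using hD.itemCredit_le x S i k j y
  have hsum := Finset.sum_le_sum fun y (_ : y ∈ D.shared.toFinset) => hpoint y
  rw [Finset.sum_add_distrib, Finset.sum_add_distrib, Finset.sum_ite_mem, Finset.sum_ite_eq',
    if_pos (List.mem_toFinset.2 hx), Finset.inter_eq_right.2 hU, ← Finset.card_eq_sum_ones] at hsum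
  have hT : (D.request x S i).shared.toFinset = D.shared.toFinset :=
    List.toFinset_eq_of_perm _ _ (moveToFront_perm hx)
  rwa [credit, credit, hT]

/-- Each item moved by `j` that `k` has to pass earns credit unless its credit has reached the cap,
and the cost of the request in the own list of `k` pays for the exceptions. -/
theorem Valid.card_movedAhead_add_credit_le (hD : D.Valid) (hx : x ∈ D.shared) (i : ι)
    (hk : k ∈ S) (j : ι) :
    (D.movedAhead j x).card + D.credit k j ≤ (D.request x S i).credit k j +
      (D.own k).idxOf x + if j ∈ S then (D.own j).idxOf x + 1 else 0 := by
  have hsat := hD.card_saturated_le k j x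
  have hunsat := hD.credit_add_card_le (k := k) (j := j) hx i
    (U := (D.movedAhead j x).filter fun y => ¬(D.own j).idxOf y < (D.recent k j y).card)
    (fun y hy => ahead_subset_toFinset _ _ (Finset.mem_filter.1 (Finset.mem_filter.1 hy).1).1)
    fun y hy => by
      obtain ⟨hy, hcap⟩ := Finset.mem_filter.1 hy
      exact hD.itemCredit_lt i hk hy (not_lt.1 hcap)
  have hsplit := Finset.card_filter_add_card_filter_not (s := D.movedAhead j x)
    fun y => (D.own j).idxOf y < (D.recent k j y).card
  omega

variable [Fintype ι]

/-- The potential of the amortized analysis: the total credit between distinct processes. -/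
def potential (D : History ι α) : ℕ := ∑ k, ∑ j ∈ Finset.univ.erase k, D.credit k j

theorem Valid.potential_le (hD : D.Valid) :
    D.potential ≤ (Fintype.card ι * D.shared.length) ^ 2 := by
  have hitem : ∀ k j, ∀ y ∈ D.shared.toFinset, D.itemCredit k j y ≤ D.shared.length :=
    fun k j y hy => (min_le_right _ _).trans <| (hD.perm j).length_eq ▸
      List.idxOf_lt_length_of_mem ((hD.perm j).mem_iff.2 (List.mem_toFinset.1 hy))
  have hcredit : ∀ k j, D.credit k j ≤ D.shared.length ^ 2 := fun k j => by
    refine (Finset.sum_le_card_nsmul _ _ _ (hitem k j)).trans ?_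
    rw [smul_eq_mul, sq]
    exact Nat.mul_le_mul_right _ (List.toFinset_card_le _)
  calc D.potential ≤ ∑ _k : ι, ∑ _j : ι, D.shared.length ^ 2 :=
        Finset.sum_le_sum fun k _ => (Finset.sum_le_sum fun j _ => hcredit k j).trans
          (Finset.sum_le_sum_of_subset (Finset.erase_subset k _))
    _ = (Fintype.card ι * D.shared.length) ^ 2 := by
        simp only [Finset.sum_const, Finset.card_univ, smul_eq_mul]
        ring

theorem Valid.idxOf_add_sum_credit_le (hD : D.Valid) (hx : x ∈ D.shared) (i : ι)
    (hk : k ∈ S) :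
    (D.shared.idxOf x + 1) + ∑ j ∈ Finset.univ.erase k, D.credit k j ≤
      ∑ j ∈ Finset.univ.erase k, (D.request x S i).credit k j +
      Fintype.card ι * ((D.own k).idxOf x + 1) +
      ∑ j ∈ Finset.univ.erase k, if j ∈ S then (D.own j).idxOf x + 1 else 0 := by
  have hothers := Finset.sum_le_sum fun j (_ : j ∈ Finset.univ.erase k) =>
    hD.card_movedAhead_add_credit_le hx i hk j
  simp only [Finset.sum_add_distrib, Finset.sum_const, smul_eq_mul, Finset.card_erase_of_mem,
    Finset.mem_univ, Finset.card_univ] at hothers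
  have hself := hD.card_movedAhead_self_le k x
  have hmoved := Finset.add_sum_erase Finset.univ (fun j => (D.movedAhead j x).card)
    (Finset.mem_univ k)
  rw [hD.sum_card_movedAhead x] at hmoved
  obtain ⟨m, hm⟩ : ∃ m, Fintype.card ι = m + 1 :=
    Nat.exists_eq_add_one.2 (Fintype.card_pos_iff.2 ⟨k⟩)
  rw [hm, Nat.add_sub_cancel] at hothers
  rw [hm]
  linarith

theorem Valid.cost_add_potential_le (hD : D.Valid) (hx : x ∈ D.shared) (S : Finset ι) (i : ι) :
    S.card * (D.shared.idxOf x + 1) + D.potential + ∑ k ∈ S, ((D.own k).idxOf x + 1) ≤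
      2 * Fintype.card ι * ∑ k ∈ S, ((D.own k).idxOf x + 1) + (D.request x S i).potential := by
  set loss : ι → ℕ := fun j => if j ∈ S then (D.own j).idxOf x + 1 else 0 with hloss
  have hrow : ∀ k, (if k ∈ S then D.shared.idxOf x + 1 else 0) +
      ∑ j ∈ Finset.univ.erase k, D.credit k j ≤
      ∑ j ∈ Finset.univ.erase k, (D.request x S i).credit k j + Fintype.card ι * loss k +
      ∑ j ∈ Finset.univ.erase k, loss j := fun k => by
    by_cases hk : k ∈ S
    · simpa only [hloss, if_pos hk] using hD.idxOf_add_sum_credit_le hx i hk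
    · simpa [hloss, hk, Finset.sum_add_distrib] using
        Finset.sum_le_sum fun j (_ : j ∈ Finset.univ.erase k) =>
          hD.credit_add_card_le (S := S) (k := k) (j := j) hx i (Finset.empty_subset _) (by simp)
  have hsum := Finset.sum_le_sum fun k (_ : k ∈ Finset.univ) => hrow k
  have hlosses : ∑ k, ∑ j ∈ Finset.univ.erase k, loss j + ∑ k, loss k =
      Fintype.card ι * ∑ k, loss k := by
    simp [← Finset.sum_add_distrib, Finset.sum_erase_add]
  have htotal : ∑ k, loss k = ∑ k ∈ S, ((D.own k).idxOf x + 1) := by simp [hloss]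
  have hcost : ∑ k, (if k ∈ S then D.shared.idxOf x + 1 else 0) =
      S.card * (D.shared.idxOf x + 1) := by simp
  simp only [Finset.sum_add_distrib, ← Finset.mul_sum] at hsum
  simp only [potential]
  rw [hcost] at hsum
  rw [htotal] at hsum hlosses
  linarith

end History

end Distributed

section Execution

variable {α : Type*} {p : ℕ}

/-- The requests of a process for which the item has not yet been found, neither by the process
nor by another one during the current search. -/
def Searcher.unfound (P : Searcher α) : List α :=
  if P.foundAt = none then P.pending else P.pending.tail

/-- The number of item accesses that are already determined, but not yet made, minus the number
of those that are made, but wait for the length of their search to be determined. -/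
def Searcher.balance (P : Searcher α) : ℤ := P.foundAt.getD 0 - P.inspected

/-- The total length of the searches whose item has been found, completed or not. -/
def Config.settledCost (C : Config p α) : ℤ := C.cost + ∑ i, (C.procs i).balance

variable [DecidableEq α] {C : Config p α} {D : History (Fin p) α} {S : Finset (Fin p)}
  {i : Fin p} {a x : α} {rest : List α} {n : ℕ} {A : ℤ}

/-- The configuration after the item `a` has been moved to the front and the processes in `S`,
including the one that moves it, have learned that they find it in location `k`. -/
def Config.announce (C : Config p α) (S : Finset (Fin p)) (a : α) (k : ℕ) : Config p α :=
  { C with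
    list := moveToFront a C.list
    procs := fun j => if j ∈ S then { C.procs j with foundAt := some k } else C.procs j }

/-- The processes that find the item `a` when the process `i` finds it. -/
def Config.finders (C : Config p α) (i : Fin p) (a : α) : Finset (Fin p) :=
  Finset.univ.filter fun j => j = i ∨ (C.procs j).pending.head? = some a ∧
    0 < (C.procs j).inspected ∧ (C.procs j).foundAt = none

theorem step_eq_step_announce (hpending : (C.procs i).pending = a :: rest)
    (hfound : (C.procs i).foundAt = none) (hget : C.list[(C.procs i).inspected]? = some a) :
    step C i = step (C.announce (C.finders i a) a ((C.procs i).inspected + 1)) i := by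
  have hi : i ∈ C.finders i a := by simp [Config.finders]
  simp only [step, Config.announce, hpending, hfound, hget, hi, if_true, moveToFront]
  congr 1
  funext j
  rcases eq_or_ne j i with rfl | hj
  · simp
  · simp [hj, Config.finders, Searcher.notify]

/-- The invariant that relates an execution on a list of `n` items to its history `D`. The constant
`A` will be `2 * p - 1` times the cost of sequential Move-to-Front on all requests, in the own
lists. Then, up to the potential, the settled cost is at most `2 * p - 1` times the part of that
cost that belongs to requests whose item has been found. -/
structure Accounts (n : ℕ) (A : ℤ) (C : Config p α) (D : History (Fin p) α) : Prop where
  valid : D.Valid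
  shared_eq : D.shared = C.list
  length_eq : C.list.length = n
  idle : ∀ j, (C.procs j).pending = [] → (C.procs j).inspected = 0
  settledCost_le : C.settledCost +
    (2 * p - 1) * ∑ j, (mtfCost (D.own j) (C.procs j).unfound : ℤ) ≤ A + D.potential

theorem Accounts.access (h : Accounts n A C D) {Q : Searcher α}
    (hunfound : Q.unfound = (C.procs i).unfound) (hbalance : Q.balance + 1 = (C.procs i).balance)
    (hidle : Q.pending = [] → Q.inspected = 0) (M : List (Fin p × α)) :
    Accounts n A ⟨C.list, Function.update C.procs i Q, M, C.cost + 1⟩ D where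
  valid := h.valid
  shared_eq := h.shared_eq
  length_eq := h.length_eq
  idle j := by
    rcases eq_or_ne j i with rfl | hj
    · simpa using hidle
    · simpa [hj] using h.idle j
  settledCost_le := by
    have hprocs : ∀ j, (Function.update C.procs i Q j).unfound = (C.procs j).unfound ∧
        (Function.update C.procs i Q j).balance + (if j = i then 1 else 0) =
          (C.procs j).balance := fun j => by
      rcases eq_or_ne j i with rfl | hj <;> simp [*]
    have hsum := Finset.sum_congr rfl fun j (_ : j ∈ Finset.univ) => (hprocs j).2
    rw [Finset.sum_add_distrib, Finset.sum_ite_eq', if_pos (Finset.mem_univ i)] at hsum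
    have hle := h.settledCost_le
    simp only [Config.settledCost, hprocs] at hle ⊢
    push_cast
    linarith

theorem Accounts.announce (h : Accounts n A C D) (hx : x ∈ C.list) (hi : i ∈ S)
    (hS : ∀ j ∈ S, (C.procs j).pending.head? = some x ∧ (C.procs j).foundAt = none) :
    Accounts n A (C.announce S x (C.list.idxOf x + 1)) (D.request x S i) where
  valid := h.valid.request (h.shared_eq ▸ hx) hi
  shared_eq := congrArg (moveToFront x) h.shared_eq
  length_eq := (moveToFront_perm hx).length_eq.trans h.length_eq
  idle j := by
    by_cases hj : j ∈ S <;> simpa [Config.announce, hj] using h.idle j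
  settledCost_le := by
    have hbalance : ∀ j, ((C.announce S x (C.list.idxOf x + 1)).procs j).balance =
        (C.procs j).balance + if j ∈ S then (C.list.idxOf x : ℤ) + 1 else 0 := fun j => by
      by_cases hj : j ∈ S
      · simp only [Config.announce, Searcher.balance, hj, if_true, (hS j hj).2,
          Option.getD_some, Option.getD_none]
        push_cast
        ring
      · simp [Config.announce, hj]
    have hmtf : ∀ j, (mtfCost (D.own j) (C.procs j).unfound : ℤ) =
        mtfCost ((D.request x S i).own j)
          ((C.announce S x (C.list.idxOf x + 1)).procs j).unfound +
        if j ∈ S then ((D.own j).idxOf x : ℤ) + 1 else 0 := fun j => by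
      by_cases hj : j ∈ S
      · obtain ⟨rest, hrest⟩ := List.head?_eq_some_iff.1 (hS j hj).1
        simp only [Config.announce, Searcher.unfound, History.request, hj, if_true, (hS j hj).2,
          hrest, mtfCost, reduceCtorEq, if_false, List.tail_cons]
        push_cast
        ring
      · simp [Config.announce, History.request, hj]
    have hrequest := h.valid.cost_add_potential_le (h.shared_eq ▸ hx) S i
    rw [h.shared_eq, Fintype.card_fin] at hrequest
    zify at hrequest
    have hcost : (C.announce S x (C.list.idxOf x + 1)).cost = C.cost := rfl
    have hle := h.settledCost_le
    simp only [Config.settledCost, hcost, hbalance, hmtf, Finset.sum_add_distrib,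
      Finset.sum_ite_mem, Finset.univ_inter, Finset.sum_const, nsmul_eq_mul] at hle hrequest ⊢
    linarith

theorem Accounts.step_of_not_found (h : Accounts n A C D)
    (hget : ∀ a, (C.procs i).pending.head? = some a → (C.procs i).foundAt = none →
      C.list[(C.procs i).inspected]? ≠ some a) :
    Accounts n A (step C i) D := by
  unfold step
  rcases hpending : (C.procs i).pending with _ | ⟨a, rest⟩
  · exact h
  have hgoOn := h.access (i := i) (Q := { C.procs i with inspected := (C.procs i).inspected + 1 })
    rfl (by simp only [Searcher.balance]; push_cast; ring) (by simp [hpending]) C.served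
  rcases hfound : (C.procs i).foundAt with _ | k
  · simpa [hget a (by simp [hpending]) hfound, hpending, hfound] using hgoOn
  · by_cases hk : (C.procs i).inspected + 1 = k
    · have hcomplete := h.access (i := i) (Q := ⟨rest, 0, none⟩)
        (by simp [Searcher.unfound, hpending, hfound])
        (by simp [Searcher.balance, hfound, ← hk]) (fun _ => rfl) (C.served ++ [(i, a)])
      simpa [hk] using hcomplete
    · simpa [hk, hpending, hfound] using hgoOn

theorem Accounts.exists_step (h : Accounts n A C D) (i : Fin p) :
    ∃ D', Accounts n A (step C i) D' := by
  by_cases hget : ∃ a rest, (C.procs i).pending = a :: rest ∧ (C.procs i).foundAt = none ∧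
      C.list[(C.procs i).inspected]? = some a
  · obtain ⟨a, rest, hpending, hfound, hget⟩ := hget
    have hx : a ∈ C.list := List.mem_of_getElem? hget
    have hidx : (C.procs i).inspected = C.list.idxOf a := by
      obtain ⟨hlt, rfl⟩ := List.getElem?_eq_some_iff.1 hget
      exact ((h.shared_eq ▸ h.valid.nodup).idxOf_getElem _ hlt).symm
    have hi : i ∈ C.finders i a := by simp [Config.finders]
    have hfinders : ∀ j ∈ C.finders i a,
        (C.procs j).pending.head? = some a ∧ (C.procs j).foundAt = none := fun j hj => by
      rcases (Finset.mem_filter.1 hj).2 with rfl | ⟨hhead, -, hnone⟩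
      · exact ⟨by rw [hpending, List.head?_cons], hfound⟩
      · exact ⟨hhead, hnone⟩
    rw [step_eq_step_announce hpending hfound hget, hidx]
    refine ⟨_, (h.announce hx hi hfinders).step_of_not_found fun b _ hnone => ?_⟩
    simp [Config.announce, hi] at hnone
  · exact ⟨D, h.step_of_not_found fun a hhead hfound hget' => hget <| by
      obtain ⟨rest, hrest⟩ := List.head?_eq_some_iff.1 hhead
      exact ⟨a, rest, hrest, hfound, hget'⟩⟩

theorem Accounts.exists_foldl_step (h : Accounts n A C D) (s : List (Fin p)) :
    ∃ D', Accounts n A (s.foldl step C) D' := by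
  induction s generalizing C D with
  | nil => exact ⟨D, h⟩
  | cons i s ih =>
    obtain ⟨D', h'⟩ := h.exists_step i
    exact ih h'

theorem Accounts.init {L : List α} (hL : L.Nodup) (σ : Fin p → List α) (i₀ : Fin p) :
    Accounts L.length ((2 * p - 1) * ∑ i, (mtfCost L (σ i) : ℤ)) (Config.init L σ)
      (History.init L i₀) where
  valid := History.Valid.init hL i₀
  shared_eq := rfl
  length_eq := rfl
  idle _ _ := rfl
  settledCost_le := by
    simp [Config.settledCost, Config.init, History.init, Searcher.balance, Searcher.unfound]

theorem Accounts.cost_le (h : Accounts n A C D) (hdone : ∀ j, (C.procs j).pending = []) :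
    (C.cost : ℤ) ≤ A + (p * n : ℤ) ^ 2 := by
  have hbalance : 0 ≤ ∑ j, (C.procs j).balance := Finset.sum_nonneg fun j _ => by
    simp [Searcher.balance, h.idle j (hdone j)]
  have hunfound : ∀ j, (C.procs j).unfound = [] := fun j => by simp [Searcher.unfound, hdone j]
  have hpot := h.valid.potential_le
  rw [h.shared_eq, h.length_eq, Fintype.card_fin] at hpot
  zify at hpot
  have hle := h.settledCost_le
  simp only [Config.settledCost, hunfound, mtfCost, Nat.cast_zero, Finset.sum_const_zero,
    mul_zero, add_zero] at hle
  linarith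

theorem dmtfCost_le {L : List α} (hL : L.Nodup) (σ : Fin p → List α) {s : List (Fin p)}
    (hs : ∀ i, ((dmtf L σ s).procs i).pending = []) :
    (dmtfCost L σ s : ℤ) ≤ (2 * p - 1) * ∑ i, (mtfCost L (σ i) : ℤ) + (p * L.length) ^ 2 := by
  cases s with
  | nil =>
    have hσ : ∀ i, σ i = [] := hs
    simp only [dmtfCost, dmtf, List.foldl_nil, Config.init, hσ, mtfCost, Nat.cast_zero,
      Finset.sum_const_zero, mul_zero, zero_add]
    positivity
  | cons i₀ s =>
    obtain ⟨D, hD⟩ := (Accounts.init hL σ i₀).exists_foldl_step (i₀ :: s)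
    exact hD.cost_le hs

end Execution

end ListAccess

theorem mainTheorem4_general {α : Type*} [DecidableEq α] {p : ℕ} {L I : List α} (hL : L.Nodup)
    {σ : Fin p → List α} (hI : ∀ a ∈ I, a ∈ L) (hσ : ∀ i, (σ i).Sublist I) {s : List (Fin p)}
    (hs : ∀ i, ((ListAccess.dmtf L σ s).procs i).pending = []) :
    (ListAccess.dmtfCost L σ s : ℝ) ≤
      (4 * (p : ℝ) ^ 2 - 2 * (p : ℝ)) * (ListAccess.opt L I : ℝ) + (p * L.length : ℝ) ^ 2 := by
  have hdmtf : (ListAccess.dmtfCost L σ s : ℝ) ≤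
      (2 * p - 1) * ∑ i, (ListAccess.mtfCost L (σ i) : ℝ) + (p * L.length) ^ 2 := by
    exact_mod_cast ListAccess.dmtfCost_le hL σ hs
  have hmtf : ∀ i, (ListAccess.mtfCost L (σ i) : ℝ) ≤ 2 * ListAccess.opt L I := fun i => by
    exact_mod_cast ListAccess.mtfCost_le_two_mul_opt hL hI (hσ i)
  have hsum := Finset.sum_le_card_nsmul Finset.univ _ _ fun i _ => hmtf i
  rw [Finset.card_univ, Fintype.card_fin, nsmul_eq_mul] at hsum
  rcases p.eq_zero_or_pos with rfl | hp
  · simpa using hdmtf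
  have hp' : (1 : ℝ) ≤ p := by exact_mod_cast hp
  linarith [mul_le_mul_of_nonneg_left hsum (by linarith : (0 : ℝ) ≤ 2 * p - 1)]

theorem mainTheorem4 (p ℓ : ℕ) :
    ∃ K : ℝ, ∀ (L₀ : List (Fin ℓ)), L₀.Perm (List.finRange ℓ) →
      ∀ (σ : Fin p → List (Fin ℓ)) (M₁ M₂ : List (Fin p × Fin ℓ)),
        ListAccess.IsMerge σ M₁ → ListAccess.IsMerge σ M₂ →
          ∀ s : List (Fin p), ListAccess.DMTFServes L₀ σ s M₁ →
            (ListAccess.dmtfCost L₀ σ s : ℝ) ≤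
              (4 * (p : ℝ) ^ 2 - 2 * (p : ℝ)) *
                (ListAccess.opt L₀ (M₂.map Prod.snd) : ℝ) + K := by
  refine ⟨(p * ℓ) ^ 2, fun L₀ hL₀ σ _ M₂ _ hM₂ s hs => ?_⟩
  have hlen : L₀.length = ℓ := by simpa using hL₀.length_eq
  simpa only [hlen] using mainTheorem4_general (hL₀.nodup_iff.2 (List.nodup_finRange ℓ))
    (fun a _ => hL₀.mem_iff.2 (List.mem_finRange a))
    (fun i => hM₂ i ▸ List.filter_sublist.map Prod.snd) hs.1
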